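/- All graphs are finite, simple and undirected. A tree decomposition of a graph $G$ is a pair $(T,\{X_t : t\in V(T)\})$ where $T$ is a tree and $X_t\subseteq V(G)$ for each $t$, such that $\bigcup_t X_t=V(G)$, for each edge $uv$ of $G$ some $X_t$ contains both $u$ and $v$, and for each $u\in V(G)$ the set $\{t\in V(T) : u\in X_t\}$ induces a connected subtree of $T$. Its width is $\max_t |X_t|-1$, and the treewidth $\mathrm{tw}(G)$ is the minimum width of a tree decomposition of $G$ (with the convention that the graph without vertices has treewidth $0$). The clique number $\omega(G)$ is the maximum size of a clique in $G$. A graph is $H$-subgraph-free if it has no (not necessarily induced) subgraph isomorphic to $H$. A class $\mathcal{G}$ of graphs is $(\mathrm{tw},\omega)$-bounded if there is a function $f:\mathbb{N}\to\mathbb{N}$ such that $\mathrm{tw}(G')\le f(\omega(G'))$ for every $G\in\mathcal{G}$ and every induced subgraph $G'$ of $G$; it has bounded treewidth if there is a constant $c$ such that $\mathrm{tw}(G)\le c$ for all $G\in\mathcal{G}$. A subdivided claw is a graph obtained from the claw $K_{1,3}$ by replacing each edge with a path of length at least one. Let $\mathcal{S}$ be the class of graphs in which every connected component is either a path (possibly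 with a single vertex) or a subdivided claw. **Theorem.** For every graph $H$, the following conditions are equivalent. 1. The class of $H$-subgraph-free graphs is $(\mathrm{tw},\omega)$-bounded. 2. The class of $H$-subgraph-free graphs has bounded treewidth. 3. $H\in\mathcal{S}$. -/

import Mathlib

universe u

namespace TwOmega

/-- A tree decomposition of a graph `G`: a (finite) tree together with a bag of vertices of `G` for
each node of the tree, such that the bags cover all vertices and all edges, and the nodes whose bags
contain a given vertex induce a connected subtree. -/
structure TreeDecomposition {V : Type u} (G : SimpleGraph V) where
  /-- the nodes of the tree -/
  Node : Type
  finite_node : Finite Node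
  /-- the tree -/
  tree : SimpleGraph Node
  isTree : tree.IsTree
  /-- the bags -/
  bag : Node → Finset V
  vertex_mem : ∀ v : V, ∃ t, v ∈ bag t
  edge_mem : ∀ ⦃v w : V⦄, G.Adj v w → ∃ t, v ∈ bag t ∧ w ∈ bag t
  connected : ∀ v : V, (tree.induce {t | v ∈ bag t}).Connected

/-- The width of a tree decomposition: the largest size of a bag, minus one. The subtraction
truncates only if all bags are empty, that is, only for a graph without vertices. -/
noncomputable def TreeDecomposition.width {V : Type u} {G : SimpleGraph V}
    (D : TreeDecomposition G) : ℕ :=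
  (⨆ t : D.Node, (D.bag t).card) - 1

/-- The treewidth of a finite graph: the minimum width of a tree decomposition
(`0` for the graph without vertices). -/
noncomputable def treewidth {V : Type u} (G : SimpleGraph V) : ℕ :=
  sInf {k : ℕ | ∃ D : TreeDecomposition G, D.width = k}

/-- A class of finite graphs. -/
abbrev GraphClass : Type (u + 1) := ∀ (V : Type u) [Finite V], SimpleGraph V → Prop

/-- A graph class is `(tw, ω)`-bounded if there is a function `f` such that
`tw(G') ≤ f(ω(G'))` for every induced subgraph `G'` of every graph in the class. -/
def IsTwOmegaBounded (𝒢 : GraphClass.{u}) : Prop :=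
  ∃ f : ℕ → ℕ, ∀ (V : Type u) [Finite V] (G : SimpleGraph V), 𝒢 V G →
    ∀ s : Set V, treewidth (G.induce s) ≤ f (G.induce s).cliqueNum

/-- A graph class has bounded treewidth if some constant bounds the treewidth of all its members. -/
def HasBoundedTreewidth (𝒢 : GraphClass.{u}) : Prop :=
  ∃ c : ℕ, ∀ (V : Type u) [Finite V] (G : SimpleGraph V), 𝒢 V G → treewidth G ≤ c

/-- The class of finite graphs that do not contain `H` as a (not necessarily induced) subgraph. -/
def subgraphFree {W : Type u} (H : SimpleGraph W) : GraphClass.{u} :=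
  fun _ _ G => H.Free G

/-- The graph obtained from the claw `K_{1,3}` by replacing its `i`-th edge with a path of length
`ℓ i` (for `ℓ i ≥ 1`): `none` is the center, and `some ⟨i, j⟩` is the vertex at distance `j + 1`
from the center on the `i`-th path. -/
def subdividedClaw (ℓ : Fin 3 → ℕ) : SimpleGraph (Option (Σ i : Fin 3, Fin (ℓ i))) :=
  SimpleGraph.fromRel fun
    | none, some ⟨_, j⟩ => (j : ℕ) = 0
    | some ⟨i, j⟩, some ⟨i', j'⟩ => i = i' ∧ (j' : ℕ) = (j : ℕ) + 1
    | _, none => False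

/-- A graph is a path if it is isomorphic to the path on `n` vertices for some `n ≥ 1`. -/
def IsPathGraph {V : Type u} (G : SimpleGraph V) : Prop :=
  ∃ n : ℕ, 1 ≤ n ∧ Nonempty (G ≃g SimpleGraph.pathGraph n)

/-- A graph is a subdivided claw if it is obtained, up to isomorphism, from the claw by replacing
each edge with a path of length at least one. -/
def IsSubdividedClaw {V : Type u} (G : SimpleGraph V) : Prop :=
  ∃ ℓ : Fin 3 → ℕ, (∀ i, 1 ≤ ℓ i) ∧ Nonempty (G ≃g subdividedClaw ℓ)

/-- Membership in the class `𝒮`: every connected component is a path or a subdivided claw. -/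
def MemS {V : Type u} (G : SimpleGraph V) : Prop :=
  ∀ C : G.ConnectedComponent, IsPathGraph C.toSimpleGraph ∨ IsSubdividedClaw C.toSimpleGraph

end TwOmega

namespace TwOmega

open SimpleGraph

universe v

/-! A clique on as many vertices as `H` contains `H`, so clique numbers are bounded on `H`-free
graphs; conversely `H`-freeness passes to induced subgraphs. This gives the equivalence of 1 and 2.

3 → 2. A rooted spanning forest of maximal total depth is normal: every edge joins an ancestor to a
descendant. If `G` contains no claw with three legs of length `l`, an edge leaving a vertex of depth
at least `l` cannot descend `2 * l` levels (`IsForest.subdividedClaw_isContained`). Hence the first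
`l` and the last `2 * l` vertices of each branch serve as bags (`hasDecomposition_of_free`). If `H`
is in `𝒮`, each component of `H` lies in a long claw. Either `G` has enough disjoint long claws to
contain `H`, or boundedly many vertices meet all long claws, and these vertices are added to every
bag (`exists_disjoint_copies_or`).

2 → 3. Split each vertex of a toroidal grid into two vertices of degree three and replace the edges
by long paths. The unions of a row and a column form a bramble, so the treewidth is large
(`not_hasDecomposition_gridLink`) and bounded treewidth forces some such graph to contain `H`. A
small connected subgraph sees only one branching vertex, so it embeds in a claw with infinite legs
and is a path or a subdivided claw (`memS_of_isContained_linkedClaws`). -/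

/-! ### Rooted trees -/

/-- The graph in which every node other than the root is joined to its parent. -/
def parentGraph {N : Type v} (root : N) (q : N → N) : SimpleGraph N :=
  SimpleGraph.fromRel fun x y => x ≠ root ∧ q x = y

theorem exists_boundary_adj {N : Type v} {T : SimpleGraph N} {x y : N} (h : T.Reachable x y)
    (S : Set N) (hx : x ∈ S) (hy : y ∉ S) : ∃ z w, T.Adj z w ∧ z ∈ S ∧ w ∉ S := by
  obtain ⟨p⟩ := h
  obtain ⟨d, -, h1, h2⟩ := p.exists_boundary_dart S hx hy
  exact ⟨d.fst, d.snd, d.adj, h1, h2⟩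

section ParentGraph

variable {N : Type v} {root : N} {q : N → N} {r : N → ℕ}

theorem parentGraph_adj_parent (hr : ∀ x, x ≠ root → r (q x) < r x) {x : N} (hx : x ≠ root) :
    (parentGraph root q).Adj x (q x) := by
  refine (SimpleGraph.fromRel_adj _ _ _).2 ⟨fun h => ?_, Or.inl ⟨hx, rfl⟩⟩
  have := hr x hx
  rw [← h] at this
  exact lt_irrefl _ this

/-- Since `r` decreases towards the parent, following parents from any node of `S` ends at `t`,
without leaving `S`. -/
theorem parentGraph_induce_connected (hr : ∀ x, x ≠ root → r (q x) < r x) {S : Set N} {t : N}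
    (ht : t ∈ S) (hS : ∀ x ∈ S, x ≠ t → x ≠ root ∧ q x ∈ S) :
    ((parentGraph root q).induce S).Connected := by
  have key : ∀ n : ℕ, ∀ x : N, r x = n → ∀ hx : x ∈ S,
      ((parentGraph root q).induce S).Reachable ⟨x, hx⟩ ⟨t, ht⟩ := by
    intro n
    induction n using Nat.strong_induction_on with
    | _ n ih =>
      intro x hn hx
      by_cases hxt : x = t
      · subst hxt; exact Reachable.refl _
      · obtain ⟨h1, h2⟩ := hS x hx hxt
        refine Reachable.trans (Adj.reachable ?_) (ih (r (q x)) (hn ▸ hr x h1) (q x) rfl h2)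
        exact parentGraph_adj_parent hr h1
  exact (connected_iff _).2
    ⟨fun x y => (key _ x rfl x.2).trans (key _ y rfl y.2).symm, ⟨⟨t, ht⟩⟩⟩

theorem parentGraph_isTree (hr : ∀ x, x ≠ root → r (q x) < r x) (hroot : q root = root) :
    (parentGraph root q).IsTree := by
  have hle : ∀ z, r (q z) ≤ r z := fun z => by
    by_cases hz : z = root
    · subst hz; rw [hroot]
    · exact (hr z hz).le
  have hit : ∀ k z, r (q^[k] z) ≤ r z := by
    intro k
    induction k with
    | zero => intro z; exact le_rfl
    | succ k ih => intro z; exact (ih (q z)).trans (hle z)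
  constructor
  · have := parentGraph_induce_connected (S := Set.univ) hr (Set.mem_univ root)
      fun x _ hx => ⟨hx, Set.mem_univ _⟩
    exact (SimpleGraph.induceUnivIso (parentGraph root q)).connected_iff.1 this
  -- The descendants of `x` form a set that is left only through the edge from `x` to `q x`. The
  -- node `q x` is outside, as `r` never increases along `q`; hence this edge is a bridge.
  · have key : ∀ x, x ≠ root → (parentGraph root q).IsBridge s(x, q x) := by
      intro x hx
      rw [isBridge_iff]
      intro hreach
      obtain ⟨z, w, hzw, ⟨k, hk⟩, hw⟩ := exists_boundary_adj hreach {z | ∃ k, q^[k] z = x}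
        ⟨0, rfl⟩ (fun ⟨k, hk⟩ => by
          have := hit k (q x)
          rw [hk] at this
          exact absurd (hr x hx) (not_lt.2 this))
      rw [deleteEdges_adj] at hzw
      obtain ⟨hadj, hne⟩ := hzw
      rcases ((SimpleGraph.fromRel_adj _ _ _).1 hadj).2 with ⟨-, h⟩ | ⟨-, h⟩
      · cases k with
        | zero =>
          apply hne
          have : z = x := hk
          rw [← h, this]; rfl
        | succ k => exact hw ⟨k, by rw [← h]; exact hk⟩
      · exact hw ⟨k + 1, by rw [Function.iterate_succ_apply, h]; exact hk⟩
    rw [isAcyclic_iff_forall_adj_isBridge]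
    intro x y hxy
    rcases ((SimpleGraph.fromRel_adj _ _ _).1 hxy).2 with ⟨h1, h⟩ | ⟨h1, h⟩
    · rw [← h]; exact key x h1
    · rw [← h, Sym2.eq_swap]; exact key y h1

end ParentGraph

/-! ### Tree decompositions with small bags -/

section Decomposition

variable {V : Type u} {G : SimpleGraph V}

/-- `G` has a tree decomposition all of whose bags have at most `k` elements. -/
def HasDecomposition (G : SimpleGraph V) (k : ℕ) : Prop :=
  ∃ D : TreeDecomposition G, ∀ t, (D.bag t).card ≤ k

/-- The nodes of a `TreeDecomposition` live in `Type`, so a tree from another universe is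
transported to some `Fin n`. -/
theorem HasDecomposition.of_tree {N : Type v} [Finite N] {T : SimpleGraph N} (hT : T.IsTree)
    (bag : N → Finset V) {k : ℕ} (hk : ∀ t, (bag t).card ≤ k) (hV : ∀ v, ∃ t, v ∈ bag t)
    (hE : ∀ ⦃v w⦄, G.Adj v w → ∃ t, v ∈ bag t ∧ w ∈ bag t)
    (hC : ∀ v, (T.induce {t | v ∈ bag t}).Connected) : HasDecomposition G k := by
  obtain ⟨n, ⟨e⟩⟩ := Finite.exists_equiv_fin N
  refine ⟨{ Node := Fin n
            finite_node := inferInstance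
            tree := T.comap e.symm
            isTree := (Iso.comap e.symm T).isTree_iff.2 hT
            bag := fun t => bag (e.symm t)
            vertex_mem := fun v => ?_
            edge_mem := fun v w h => ?_
            connected := fun v => ?_ }, fun t => hk _⟩
  · obtain ⟨t, ht⟩ := hV v
    exact ⟨e t, by simpa using ht⟩
  · obtain ⟨t, ht⟩ := hE h
    exact ⟨e t, by simpa using ht⟩
  · let f : (T.comap e.symm).induce {t | v ∈ bag (e.symm t)} ≃g T.induce {t | v ∈ bag t} :=
      ⟨e.symm.subtypeEquiv fun a => Iff.rfl, Iff.rfl⟩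
    exact f.connected_iff.2 (hC v)

theorem HasDecomposition.treewidth_le {k : ℕ} (h : HasDecomposition G k) : treewidth G ≤ k - 1 := by
  obtain ⟨D, hD⟩ := h
  have : treewidth G ≤ D.width := Nat.sInf_le ⟨D, rfl⟩
  refine this.trans (Nat.sub_le_sub_right ?_ 1)
  have := D.isTree.connected.nonempty
  exact ciSup_le hD

theorem HasDecomposition.card [Finite V] (G : SimpleGraph V) :
    HasDecomposition G (Nat.card V) := by
  have := Fintype.ofFinite V
  refine HasDecomposition.of_tree (N := Unit) (T := ⊥) IsTree.of_subsingleton (fun _ => Finset.univ)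
    ?_ (fun v => ⟨(), Finset.mem_univ v⟩) (fun v w _ => ⟨(), Finset.mem_univ v, Finset.mem_univ w⟩)
    fun v => ?_
  · simp
  · exact (connected_iff _).2
      ⟨fun x y => by rw [Subsingleton.elim x y], ⟨⟨(), Finset.mem_univ v⟩⟩⟩

theorem hasDecomposition_of_treewidth_le [Finite V] {k : ℕ} (h : treewidth G ≤ k) :
    HasDecomposition G (k + 1) := by
  -- The infimum of the empty set would be `0`; the decomposition with a single bag ensures that the
  -- treewidth is attained.
  have hne : {k : ℕ | ∃ D : TreeDecomposition G, D.width = k}.Nonempty := by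
    obtain ⟨D, -⟩ := HasDecomposition.card G
    exact ⟨_, D, rfl⟩
  obtain ⟨D, hD⟩ := Nat.sInf_mem hne
  refine ⟨D, fun t => ?_⟩
  have := D.finite_node
  have h1 : (D.bag t).card ≤ ⨆ t : D.Node, (D.bag t).card :=
    le_ciSup (f := fun t => (D.bag t).card) (Set.finite_range _).bddAbove t
  have h2 : (⨆ t : D.Node, (D.bag t).card) - 1 = treewidth G := hD
  omega

theorem HasDecomposition.of_iso {V' : Type v} {G' : SimpleGraph V'} (e : G ≃g G') {k : ℕ}
    (h : HasDecomposition G k) : HasDecomposition G' k := by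
  obtain ⟨D, hD⟩ := h
  refine ⟨{ Node := D.Node
            finite_node := D.finite_node
            tree := D.tree
            isTree := D.isTree
            bag := fun t => (D.bag t).map e.toEquiv.toEmbedding
            vertex_mem := fun v => ?_
            edge_mem := fun v w h => ?_
            connected := fun v => ?_ }, fun t => by simpa using hD t⟩
  · obtain ⟨t, ht⟩ := D.vertex_mem (e.symm v)
    exact ⟨t, Finset.mem_map.2 ⟨_, ht, e.apply_symm_apply v⟩⟩
  · obtain ⟨t, ht, ht'⟩ := D.edge_mem (e.symm.map_adj_iff.2 h)
    exact ⟨t, Finset.mem_map.2 ⟨_, ht, e.apply_symm_apply v⟩,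
      Finset.mem_map.2 ⟨_, ht', e.apply_symm_apply w⟩⟩
  · have : {t | v ∈ (D.bag t).map e.toEquiv.toEmbedding} = {t | e.symm v ∈ D.bag t} := by
      ext t
      simp only [Set.mem_ofPred_eq, Finset.mem_map]
      constructor
      · rintro ⟨w, hw, rfl⟩
        simpa using hw
      · exact fun hw => ⟨_, hw, e.apply_symm_apply v⟩
    rw [this]
    exact D.connected _

/-- Adding a fixed set of vertices to all bags. -/
theorem HasDecomposition.of_induce_compl {X : Finset V} {k : ℕ}
    (h : HasDecomposition (G.induce {v | v ∉ X}) k) : HasDecomposition G (k + X.card) := by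
  classical
  obtain ⟨D, hD⟩ := h
  have hmem : ∀ {v t} (hv : v ∉ X), v ∈ (D.bag t).map (.subtype _) ∪ X ↔ ⟨v, hv⟩ ∈ D.bag t := by
    intro v t hv
    simp [hv]
  obtain ⟨t₀⟩ := D.isTree.connected.nonempty
  refine ⟨{ Node := D.Node
            finite_node := D.finite_node
            tree := D.tree
            isTree := D.isTree
            bag := fun t => (D.bag t).map (.subtype _) ∪ X
            vertex_mem := fun v => ?_
            edge_mem := fun v w h => ?_
            connected := fun v => ?_ }, fun t => ?_⟩
  · by_cases hv : v ∈ X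
    · exact ⟨t₀, Finset.mem_union_right _ hv⟩
    · obtain ⟨t, ht⟩ := D.vertex_mem ⟨v, hv⟩
      exact ⟨t, (hmem hv).2 ht⟩
  · by_cases hv : v ∈ X
    · by_cases hw : w ∈ X
      · exact ⟨t₀, Finset.mem_union_right _ hv, Finset.mem_union_right _ hw⟩
      · obtain ⟨t, ht⟩ := D.vertex_mem ⟨w, hw⟩
        exact ⟨t, Finset.mem_union_right _ hv, (hmem hw).2 ht⟩
    · by_cases hw : w ∈ X
      · obtain ⟨t, ht⟩ := D.vertex_mem ⟨v, hv⟩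
        exact ⟨t, (hmem hv).2 ht, Finset.mem_union_right _ hw⟩
      · obtain ⟨t, ht, ht'⟩ := D.edge_mem (v := ⟨v, hv⟩) (w := ⟨w, hw⟩) h
        exact ⟨t, (hmem hv).2 ht, (hmem hw).2 ht'⟩
  · by_cases hv : v ∈ X
    · have : {t | v ∈ (D.bag t).map (.subtype _) ∪ X} = Set.univ :=
        Set.eq_univ_of_forall fun t => Finset.mem_union_right _ hv
      rw [this]
      exact (SimpleGraph.induceUnivIso D.tree).connected_iff.2 D.isTree.connected
    · have : {t | v ∈ (D.bag t).map (.subtype _) ∪ X} = {t | ⟨v, hv⟩ ∈ D.bag t} :=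
        Set.ext fun t => hmem hv
      rw [this]
      exact D.connected _
  · refine (Finset.card_union_le _ _).trans (Nat.add_le_add_right ?_ _)
    rw [Finset.card_map]
    exact hD t

end Decomposition

/-! ### A lower bound for the bags from brambles -/

theorem reachable_deleteEdges_of_induce {N : Type v} {T : SimpleGraph N} {S : Set N} {t t' : N}
    (ht : t ∉ S) {x y : S} (h : (T.induce S).Reachable x y) :
    (T.deleteEdges {s(t, t')}).Reachable x y := by
  refine h.map (G' := T.deleteEdges {s(t, t')}) ⟨Subtype.val, fun {a b} hab => ?_⟩
  rw [deleteEdges_adj]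
  refine ⟨hab, fun hmem => ht ?_⟩
  have : t ∈ s(a.1, b.1) := by
    rw [Set.mem_singleton_iff.1 hmem]; exact Sym2.mem_mk_left _ _
  rcases Sym2.mem_iff.1 this with h | h <;> rw [h]
  exacts [a.2, b.2]

/-- The subtrees of adjacent vertices share a node, so the nodes whose bags meet `B` hang together.
They avoid `t`, hence no edge at `t` is needed to connect them. -/
theorem TreeDecomposition.reachable_of_connected {V : Type u} {G : SimpleGraph V}
    (D : TreeDecomposition G) {B : Set V} (hB : (G.induce B).Preconnected) {t t' : D.Node}
    (ht : ∀ v ∈ D.bag t, v ∉ B) {x y : D.Node} {v w : V} (hv : v ∈ B) (hw : w ∈ B)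
    (hx : v ∈ D.bag x) (hy : w ∈ D.bag y) : (D.tree.deleteEdges {s(t, t')}).Reachable x y := by
  have hsame : ∀ v ∈ B, ∀ x y, v ∈ D.bag x → v ∈ D.bag y →
      (D.tree.deleteEdges {s(t, t')}).Reachable x y := fun v hv x y hx hy =>
    reachable_deleteEdges_of_induce (S := {t | v ∈ D.bag t}) (x := ⟨x, hx⟩) (y := ⟨y, hy⟩)
      (fun h => ht v h hv) ((D.connected v).preconnected _ _)
  obtain ⟨p⟩ := hB ⟨v, hv⟩ ⟨w, hw⟩
  have key : ∀ (a b : B) (p : (G.induce B).Walk a b) (x y : D.Node), a.1 ∈ D.bag x → b.1 ∈ D.bag y →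
      (D.tree.deleteEdges {s(t, t')}).Reachable x y := by
    intro a b p
    induction p with
    | nil => exact fun x y hx hy => hsame _ (Subtype.prop _) x y hx hy
    | cons hab p ih =>
      intro x y hx hy
      obtain ⟨s, hs, hs'⟩ := D.edge_mem hab
      exact (hsame _ (Subtype.prop _) x s hx hs).trans (ih s y hs' hy)
  exact key _ _ p x y hx hy

/-- Otherwise each node points to the neighbour behind which some set missed by its bag lies. A tree
has fewer edges than nodes, so two nodes point along the same edge, from its two ends. Their sets
then lie on opposite sides of a bridge, although they touch. -/
theorem TreeDecomposition.exists_bag_hitting {V : Type u} {G : SimpleGraph V}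
    (D : TreeDecomposition G) {I : Type v} (B : I → Set V)
    (hconn : ∀ i, (G.induce (B i)).Preconnected)
    (htouch : ∀ i j, ∃ v ∈ B i, ∃ w ∈ B j, v = w ∨ G.Adj v w) :
    ∃ t, ∀ i, ∃ v ∈ D.bag t, v ∈ B i := by
  classical
  by_contra hcon
  push Not at hcon
  choose β hβ using hcon
  have := D.finite_node
  have := Fintype.ofFinite D.Node
  have hnext : ∀ t, ∃ t', D.tree.Adj t t' ∧ ∀ v ∈ B (β t), ∀ x, v ∈ D.bag x →
      (D.tree.deleteEdges {s(t, t')}).Reachable t' x := by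
    intro t
    obtain ⟨v, hv, -⟩ := htouch (β t) (β t)
    obtain ⟨s, hs⟩ := D.vertex_mem v
    have hts : t ≠ s := fun h => hβ t v (h ▸ hs) hv
    obtain ⟨p, hp⟩ := D.isTree.connected.exists_isPath t s
    cases p with
    | nil => exact absurd rfl hts
    | @cons _ t' _ hadj p =>
      refine ⟨t', hadj, fun w hw x hx => ?_⟩
      refine Reachable.trans (v := s) ?_
        (D.reachable_of_connected (hconn (β t)) (hβ t) hv hw hs hx)
      rw [reachable_deleteEdges_iff_exists_walk]
      refine ⟨p, fun h => ?_⟩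
      exact (Walk.cons_isPath_iff hadj p).1 hp |>.2 (p.fst_mem_support_of_mem_edges h)
  choose next hadj hreach using hnext
  have hcard := D.isTree.card_edgeFinset
  obtain ⟨a, -, b, -, hab, heq⟩ := Finset.exists_ne_map_eq_of_card_lt_of_maps_to
    (s := Finset.univ) (t := D.tree.edgeFinset) (f := fun t => s(t, next t))
    (by rw [Finset.card_univ]; omega) (fun t _ => by simpa using hadj t)
  simp only [Sym2.eq_iff] at heq
  obtain ⟨h, -⟩ | ⟨h1, h2⟩ := heq
  · exact hab h
  have hbridge := isAcyclic_iff_forall_adj_isBridge.1 D.isTree.isAcyclic (hadj a)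
  rw [isBridge_iff] at hbridge
  obtain ⟨v, hv, w, hw, hvw⟩ := htouch (β a) (β b)
  obtain ⟨x, hx, hx'⟩ : ∃ x, v ∈ D.bag x ∧ w ∈ D.bag x := by
    rcases hvw with rfl | hvw
    · obtain ⟨x, hx⟩ := D.vertex_mem v
      exact ⟨x, hx, hx⟩
    · exact D.edge_mem hvw
  have r1 := hreach a v hv x hx
  have r2 := hreach b w hw x hx'
  have he : s(b, next b) = s(a, next a) := by rw [h2, ← h1, Sym2.eq_swap]
  rw [he, ← h1] at r2
  exact hbridge (r2.trans r1.symm)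

/-! ### Copies of subdivided claws -/

theorem subdividedClaw_adj_none {ℓ : Fin 3 → ℕ} {i : Fin 3} {j : Fin (ℓ i)} :
    (subdividedClaw ℓ).Adj none (some ⟨i, j⟩) ↔ (j : ℕ) = 0 := by
  simp [subdividedClaw, SimpleGraph.fromRel_adj]

theorem subdividedClaw_adj_some {ℓ : Fin 3 → ℕ} {i i' : Fin 3} {j : Fin (ℓ i)} {j' : Fin (ℓ i')} :
    (subdividedClaw ℓ).Adj (some ⟨i, j⟩) (some ⟨i', j'⟩) ↔
      i = i' ∧ ((j' : ℕ) = j + 1 ∨ (j : ℕ) = j' + 1) := by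
  simp only [subdividedClaw, SimpleGraph.fromRel_adj]
  constructor
  · rintro ⟨-, ⟨h, h'⟩ | ⟨h, h'⟩⟩
    exacts [⟨h, Or.inl h'⟩, ⟨h.symm, Or.inr h'⟩]
  · rintro ⟨rfl, h⟩
    refine ⟨fun heq => ?_, ?_⟩
    · have : j = j' := by simpa using heq
      subst this
      omega
    · rcases h with h | h
      exacts [Or.inl ⟨rfl, h⟩, Or.inr ⟨rfl, h⟩]

/-- The map from the vertices of a subdivided claw given by the images of the centre and the legs. -/
def clawMap {V : Type v} {ℓ : Fin 3 → ℕ} (c : V) (g : Fin 3 → ℕ → V) :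
    Option (Σ i : Fin 3, Fin (ℓ i)) → V
  | none => c
  | some ⟨i, j⟩ => g i j

theorem clawMap_adj {V : Type v} {G : SimpleGraph V} {ℓ : Fin 3 → ℕ} {c : V} {g : Fin 3 → ℕ → V}
    (h0 : ∀ i, 0 < ℓ i → G.Adj c (g i 0))
    (h1 : ∀ i j, j + 1 < ℓ i → G.Adj (g i j) (g i (j + 1))) :
    ∀ {a b}, (subdividedClaw ℓ).Adj a b → G.Adj (clawMap c g a) (clawMap c g b) := by
  have h0' : ∀ (i : Fin 3) (j : Fin (ℓ i)), (j : ℕ) = 0 → G.Adj c (g i j) := by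
    intro i j hj
    rw [hj]
    exact h0 i (by have := j.2; omega)
  rintro (_ | ⟨i, j⟩) (_ | ⟨i', j'⟩) h
  · exact absurd h (SimpleGraph.irrefl _)
  · exact h0' i' j' (subdividedClaw_adj_none.1 h)
  · exact (h0' i j (subdividedClaw_adj_none.1 h.symm)).symm
  · obtain ⟨rfl, h | h⟩ := subdividedClaw_adj_some.1 h
    · change G.Adj (g i j) (g i j')
      rw [h]
      exact h1 i j (h ▸ j'.2)
    · change G.Adj (g i j) (g i j')
      rw [h]
      exact (h1 i j' (h ▸ j.2)).symm

theorem subdividedClaw_isContained {V : Type v} {G : SimpleGraph V} {ℓ : Fin 3 → ℕ} {c : V}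
    {g : Fin 3 → ℕ → V} (h0 : ∀ i, 0 < ℓ i → G.Adj c (g i 0))
    (h1 : ∀ i j, j + 1 < ℓ i → G.Adj (g i j) (g i (j + 1)))
    (hinj : Function.Injective (clawMap (ℓ := ℓ) c g)) : (subdividedClaw ℓ).IsContained G :=
  ⟨⟨⟨clawMap c g, clawMap_adj h0 h1⟩, hinj⟩⟩

/-! ### Rooted forests whose branches are walks in the graph -/

section Forest

variable {V : Type v}

/-- The parent function `p` and the depth function `d` describe a rooted spanning forest of `G`. -/
def IsForest (G : SimpleGraph V) (p : V → V) (d : V → ℕ) : Prop :=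
  ∀ v, d v = 0 ∨ d (p v) + 1 = d v ∧ G.Adj v (p v)

/-- The vertex `u` lies on the branch from `v` to its root. -/
def IsAncestor (p : V → V) (d : V → ℕ) (u v : V) : Prop :=
  ∃ k ≤ d v, p^[k] v = u

variable {G : SimpleGraph V} {p : V → V} {d : V → ℕ}

theorem IsForest.depth_iterate (h : IsForest G p d) (k : ℕ) :
    ∀ v, k ≤ d v → d (p^[k] v) + k = d v := by
  induction k with
  | zero => intro v _; rfl
  | succ k ih =>
    intro v hk
    obtain h0 | ⟨h1, -⟩ := h v
    · omega
    · have := ih (p v) (by omega)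
      rw [Function.iterate_succ_apply]
      omega

theorem IsForest.adj_iterate (h : IsForest G p d) {k : ℕ} {v : V} (hk : k < d v) :
    G.Adj (p^[k] v) (p^[k + 1] v) := by
  have := h.depth_iterate k v hk.le
  obtain h0 | ⟨-, h1⟩ := h (p^[k] v)
  · omega
  · rwa [Function.iterate_succ_apply']

theorem IsForest.depth_lt [Finite V] (h : IsForest G p d) (v : V) : d v < Nat.card V := by
  have hinj : Function.Injective fun k : Fin (d v + 1) => p^[(k : ℕ)] v := by
    intro a b hab
    have ha := h.depth_iterate a v (Nat.lt_succ_iff.1 a.2)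
    have hb := h.depth_iterate b v (Nat.lt_succ_iff.1 b.2)
    have : d (p^[(a : ℕ)] v) = d (p^[(b : ℕ)] v) := congrArg d hab
    exact Fin.ext (by omega)
  have := Nat.card_le_card_of_injective _ hinj
  simpa using this

theorem IsAncestor.refl (v : V) : IsAncestor p d v v := ⟨0, Nat.zero_le _, rfl⟩

/-- On a branch, a vertex is determined by its depth; this later bounds the bags. -/
theorem IsForest.isAncestor_iff (h : IsForest G p d) {u v : V} :
    IsAncestor p d u v ↔ d u ≤ d v ∧ p^[d v - d u] v = u := by
  constructor
  · rintro ⟨k, hk, rfl⟩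
    have := h.depth_iterate k v hk
    refine ⟨by omega, ?_⟩
    congr
    omega
  · rintro ⟨-, h2⟩
    exact ⟨_, Nat.sub_le _ _, h2⟩

theorem IsForest.isAncestor_parent_iff (h : IsForest G p d) {u v : V} (hv : d v ≠ 0) (huv : v ≠ u) :
    IsAncestor p d u (p v) ↔ IsAncestor p d u v := by
  obtain h0 | ⟨h1, -⟩ := h v
  · exact absurd h0 hv
  constructor
  · rintro ⟨k, hk, rfl⟩
    exact ⟨k + 1, by omega, rfl⟩
  · rintro ⟨k, hk, hku⟩
    cases k with
    | zero => exact absurd hku huv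
    | succ k => exact ⟨k, by omega, hku⟩

/-- The subtree of `u` is cut off and hung below `v`, which is not part of it. All its vertices move
down by `d v + 1 - d u > 0` levels. -/
theorem IsForest.exists_larger [Fintype V] (h : IsForest G p d) {u v : V} (huv : G.Adj u v)
    (hd : d u ≤ d v) (hanc : ¬ IsAncestor p d u v) :
    ∃ p' d', IsForest G p' d' ∧ ∑ v, d v < ∑ v, d' v := by
  classical
  let d' : V → ℕ := fun w => if IsAncestor p d u w then d w + (d v + 1 - d u) else d w
  have hd'u : d' u = d v + 1 := by
    have : d' u = d u + (d v + 1 - d u) := if_pos (IsAncestor.refl u)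
    omega
  refine ⟨Function.update p u v, d', fun w => ?_, ?_⟩
  · by_cases hw : w = u
    · subst hw
      right
      rw [Function.update_self, hd'u]
      exact ⟨by rw [show d' v = d v from if_neg hanc], huv⟩
    · rw [Function.update_of_ne hw]
      by_cases h0 : d w = 0
      · left
        have : ¬ IsAncestor p d u w := by
          rintro ⟨k, hk, hku⟩
          obtain rfl : k = 0 := by omega
          exact hw hku
        rw [show d' w = d w from if_neg this, h0]
      · right
        obtain h1 | ⟨h1, h2⟩ := h w
        · exact absurd h1 h0
        · refine ⟨?_, h2⟩
          have hiff := h.isAncestor_parent_iff h0 hw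
          simp only [d', hiff]
          split_ifs <;> omega
  · refine Finset.sum_lt_sum (fun w _ => ?_) ⟨u, Finset.mem_univ _, by omega⟩
    simp only [d']
    split_ifs <;> omega

/-- Every finite graph has a rooted spanning forest in which adjacent vertices are comparable. -/
theorem exists_normal_forest [Finite V] (G : SimpleGraph V) :
    ∃ p d, IsForest G p d ∧ ∀ u v, G.Adj u v → IsAncestor p d u v ∨ IsAncestor p d v u := by
  have := Fintype.ofFinite V
  let A : Set ℕ := {n | ∃ p d, IsForest G p d ∧ ∑ v, d v = n}
  -- All vertices are roots here; the parent of a vertex of depth `0` is arbitrary.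
  have hne : A.Nonempty := ⟨_, id, fun _ => 0, fun _ => Or.inl rfl, rfl⟩
  have hbdd : BddAbove A := by
    refine ⟨∑ _v : V, Nat.card V, ?_⟩
    rintro n ⟨p, d, h, rfl⟩
    exact Finset.sum_le_sum fun v _ => (h.depth_lt v).le
  obtain ⟨p, d, h, hmax⟩ := Nat.sSup_mem hne hbdd
  have hno : ¬ ∃ p' d', IsForest G p' d' ∧ ∑ v, d v < ∑ v, d' v := by
    rintro ⟨p', d', h', hlt⟩
    have := le_csSup hbdd ⟨p', d', h', rfl⟩
    omega
  refine ⟨p, d, h, fun u v huv => ?_⟩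
  by_contra hcon
  push Not at hcon
  rcases le_total (d u) (d v) with hd | hd
  · exact hno (h.exists_larger huv hd hcon.1)
  · exact hno (h.exists_larger huv.symm hd hcon.2)

/-- The centre is `w`. One leg goes up from `w`, one crosses to `u` and goes up from there, one goes
down from `w` towards `u`. They occupy the depths below `d w`, the last `l` up to `d u`, and the
first `l` after `d w`; since `d u - d w ≥ 2 * l`, these ranges are disjoint and depth alone proves
injectivity. -/
theorem IsForest.subdividedClaw_isContained (h : IsForest G p d) {u w : V} (huw : G.Adj w u)
    (hanc : IsAncestor p d w u) {l : ℕ} (hw : l ≤ d w) (hu : d w + 2 * l ≤ d u) :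
    (subdividedClaw fun _ => l).IsContained G := by
  obtain ⟨-, hk⟩ := h.isAncestor_iff.1 hanc
  let g : Fin 3 → ℕ → V := ![fun j => p^[j + 1] w, fun j => p^[j] u,
    fun j => p^[d u - d w - 1 - j] u]
  have hdepth0 : ∀ j, j < l → d (g 0 j) + (j + 1) = d w := fun j hj =>
    h.depth_iterate (j + 1) w (by omega)
  have hdepth1 : ∀ j, j < l → d (g 1 j) + j = d u := fun j hj =>
    h.depth_iterate j u (by omega)
  have hdepth2 : ∀ j, j < l → d (g 2 j) = d w + 1 + j := fun j hj => by
    have : d (g 2 j) + _ = d u := h.depth_iterate (d u - d w - 1 - j) u (by omega)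
    omega
  refine TwOmega.subdividedClaw_isContained (c := w) (g := g) ?_ ?_ ?_
  · intro i hl
    fin_cases i
    · exact h.adj_iterate (k := 0) (by omega)
    · exact huw
    · have := h.adj_iterate (k := d u - d w - 1) (v := u) (by omega)
      rw [show d u - d w - 1 + 1 = d u - d w by omega, hk] at this
      exact this.symm
  · intro i j hl
    fin_cases i
    · exact h.adj_iterate (k := j + 1) (by omega)
    · exact h.adj_iterate (k := j) (by omega)
    · have := h.adj_iterate (k := d u - d w - 1 - (j + 1)) (v := u) (by omega)
      rw [show d u - d w - 1 - (j + 1) + 1 = d u - d w - 1 - j by omega] at this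
      exact this.symm
  · have hleg : ∀ (i i' : Fin 3) (j j' : Fin l), d (g i j) = d (g i' j') →
        i = i' ∧ j = j' := by
      intro i i' j j' hij
      have a0 := hdepth0 j j.2
      have a1 := hdepth1 j j.2
      have a2 := hdepth2 j j.2
      have b0 := hdepth0 j' j'.2
      have b1 := hdepth1 j' j'.2
      have b2 := hdepth2 j' j'.2
      have hj := j.2
      have hj' := j'.2
      rw [Fin.ext_iff]
      fin_cases i <;> fin_cases i' <;> simp at hij ⊢ <;> omega
    have hcen : ∀ (i : Fin 3) (j : Fin l), d (g i j) ≠ d w := by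
      intro i j hij
      have a0 := hdepth0 j j.2
      have a1 := hdepth1 j j.2
      have a2 := hdepth2 j j.2
      have hj := j.2
      fin_cases i <;> simp at hij <;> omega
    rintro (_ | ⟨i, j⟩) (_ | ⟨i', j'⟩) hab
    · rfl
    · exact absurd (congrArg d hab).symm (hcen i' j')
    · exact absurd (congrArg d hab) (hcen i j)
    · obtain ⟨rfl, rfl⟩ := hleg i i' j j' (congrArg d hab)
      rfl

theorem hasDecomposition_of_free {V : Type u} [Finite V] {G : SimpleGraph V} {l : ℕ} (hl : 0 < l)
    (hG : (subdividedClaw fun _ => l).Free G) : HasDecomposition G (3 * l) := by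
  classical
  have := Fintype.ofFinite V
  obtain ⟨p, d, h, hcomp⟩ := exists_normal_forest G
  -- The extra root `none`, with empty bag, joins the trees of the forest into one tree.
  let q : Option V → Option V := fun x =>
    x.elim none fun v => if d v = 0 then none else some (p v)
  let r : Option V → ℕ := fun x => x.elim 0 fun v => d v + 1
  let bag : Option V → Finset V := fun x => x.elim ∅ fun v =>
    Finset.univ.filter fun u => IsAncestor p d u v ∧ (d u < l ∨ d v < d u + 2 * l)
  have hbag : ∀ u v, u ∈ bag (some v) ↔ IsAncestor p d u v ∧ (d u < l ∨ d v < d u + 2 * l) :=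
    fun u v => by simp [bag]
  have hself : ∀ v, v ∈ bag (some v) := fun v =>
    (hbag v v).2 ⟨IsAncestor.refl v, Or.inr (by omega)⟩
  have hr : ∀ x, x ≠ none → r (q x) < r x := by
    rintro (_ | v) hx
    · exact absurd rfl hx
    · by_cases h0 : d v = 0
      · simp [q, r, h0]
      · obtain h1 | ⟨h1, -⟩ := h v
        · exact absurd h1 h0
        · simp [q, r, h0]
          omega
  refine HasDecomposition.of_tree (parentGraph_isTree hr rfl) bag ?_ (fun v => ⟨some v, hself v⟩)
    ?_ ?_
  · rintro (_ | v)
    · exact Nat.zero_le _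
    · have hmaps : ∀ u ∈ bag (some v), d u ∈ Finset.range l ∪ Finset.Icc (d v + 1 - 2 * l) (d v) := by
        intro u hu
        obtain ⟨h1, h2⟩ := (hbag u v).1 hu
        have := (h.isAncestor_iff.1 h1).1
        simp only [Finset.mem_union, Finset.mem_range, Finset.mem_Icc]
        omega
      have hinj : Set.InjOn d (bag (some v) : Set V) := by
        intro a ha b hb hab
        have h1 := (h.isAncestor_iff.1 ((hbag a v).1 ha).1).2
        have h2 := (h.isAncestor_iff.1 ((hbag b v).1 hb).1).2
        rw [← h1, ← h2, hab]
      refine (Finset.card_le_card_of_injOn d hmaps hinj).trans ((Finset.card_union_le _ _).trans ?_)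
      rw [Finset.card_range, Nat.card_Icc]
      omega
  · have key : ∀ w u, G.Adj w u → IsAncestor p d w u → ∃ t, w ∈ bag t ∧ u ∈ bag t := by
      intro w u hwu hanc
      refine ⟨some u, (hbag w u).2 ⟨hanc, ?_⟩, hself u⟩
      by_contra hcon
      push Not at hcon
      exact hG (h.subdividedClaw_isContained hwu hanc hcon.1 hcon.2)
    intro v w hvw
    rcases hcomp v w hvw with hanc | hanc
    · exact key v w hvw hanc
    · obtain ⟨t, h1, h2⟩ := key w v hvw.symm hanc
      exact ⟨t, h2, h1⟩
  · intro u
    -- Moving from `v` to its parent keeps `u` in the bag until `u` itself is reached: `d u` is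
    -- fixed and `d v` only drops.
    refine parentGraph_induce_connected hr (t := some u) (hself u) ?_
    rintro (_ | v) hv hvu
    · simp [bag] at hv
    · have hvu : v ≠ u := fun h => hvu (h ▸ rfl)
      obtain ⟨h1, h2⟩ := (hbag u v).1 hv
      have h0 : d v ≠ 0 := by
        intro h0
        obtain ⟨k, hk, hku⟩ := h1
        obtain rfl : k = 0 := by omega
        exact hvu hku
      obtain h3 | ⟨h3, -⟩ := h v
      · exact absurd h3 h0
      refine ⟨by simp, ?_⟩
      have : q (some v) = some (p v) := by simp [q, h0]
      rw [this]
      exact (hbag u _).2 ⟨(h.isAncestor_parent_iff h0 hvu).2 h1, by omega⟩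

end Forest

/-! ### Packing copies of a graph -/

/-- Copies are collected greedily; when no further one fits, the union of those found is `X`. -/
theorem exists_disjoint_copies_or {A : Type*} [Finite A] (S : SimpleGraph A) {V : Type v} [Finite V]
    (G : SimpleGraph V) (m : ℕ) :
    (∃ f : Fin m → Copy S G, ∀ i j a b, f i a = f j b → i = j) ∨
      ∃ X : Finset V, X.card ≤ m * Nat.card A ∧ S.Free (G.induce {v | v ∉ X}) := by
  classical
  have := Fintype.ofFinite A
  induction m with
  | zero => exact Or.inl ⟨Fin.elim0, fun i => i.elim0⟩
  | succ m ih =>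
    rcases ih with ⟨f, hf⟩ | ⟨X, hX, hfree⟩
    · let X : Finset V := Finset.univ.biUnion fun i => Finset.univ.image (f i)
      by_cases hfree : S.Free (G.induce {v | v ∉ X})
      · refine Or.inr ⟨X, ?_, hfree⟩
        have : X.card ≤ ∑ _i : Fin m, Fintype.card A :=
          Finset.card_biUnion_le.trans (Finset.sum_le_sum fun i _ => Finset.card_image_le)
        rw [Finset.sum_const, Finset.card_univ, Fintype.card_fin, smul_eq_mul] at this
        rw [Nat.card_eq_fintype_card]
        nlinarith
      · obtain ⟨g⟩ := not_not.1 hfree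
        have hg : ∀ a i b, (g a).1 ≠ f i b := fun a i b hab => (g a).2 <|
          Finset.mem_biUnion.2 ⟨i, Finset.mem_univ _, Finset.mem_image.2 ⟨b, Finset.mem_univ _, hab.symm⟩⟩
        refine Or.inl ⟨Fin.cons ((Copy.induce G _).comp g) f, fun i j a b => ?_⟩
        refine Fin.cases ?_ (fun i => ?_) i <;> refine Fin.cases ?_ (fun j => ?_) j
        · exact fun _ => rfl
        · exact fun h => absurd h (hg a j b)
        · exact fun h => absurd h.symm (hg b i a)
        · exact fun h => congrArg Fin.succ (hf i j a b h)
    · exact Or.inr ⟨X, hX.trans (Nat.mul_le_mul_right _ (Nat.le_succ m)), hfree⟩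

/-- There are at most `Nat.card W` components, so each can be given a copy of `S` of its own. -/
theorem isContained_of_components {W : Type u} [Finite W] {H : SimpleGraph W} {A : Type*}
    {S : SimpleGraph A} (hH : ∀ C : H.ConnectedComponent, C.toSimpleGraph.IsContained S)
    {V : Type v} {G : SimpleGraph V} (f : Fin (Nat.card W) → Copy S G)
    (hf : ∀ i j a b, f i a = f j b → i = j) : H.IsContained G := by
  have hcard : Nat.card H.ConnectedComponent ≤ Nat.card W :=
    Nat.card_le_card_of_surjective H.connectedComponentMk fun C => C.ind fun v => ⟨v, rfl⟩
  let e : H.ConnectedComponent → Fin (Nat.card W) := fun C =>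
    Fin.castLE hcard (Finite.equivFin _ C)
  have he : Function.Injective e :=
    (Fin.castLE_injective hcard).comp (Finite.equivFin _).injective
  let c : ∀ C : H.ConnectedComponent, Copy C.toSimpleGraph G := fun C => (f (e C)).comp (hH C).some
  refine ⟨⟨homOfConnectedComponents H fun C => (c C).toHom, fun x y hxy => ?_⟩⟩
  simp only [homOfConnectedComponents_apply] at hxy
  have hC : H.connectedComponentMk x = H.connectedComponentMk y := he (hf _ _ _ _ hxy)
  have key : ∀ (C D : H.ConnectedComponent) (hx : x ∈ C) (hy : y ∈ D), C = D →
      (c C).toHom ⟨x, hx⟩ = (c D).toHom ⟨y, hy⟩ → x = y := by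
    rintro C _ hx hy rfl h
    exact congrArg Subtype.val ((c C).injective h)
  exact key _ _ _ _ hC hxy

theorem isContained_subdividedClaw {U : Type u} [Finite U] {C : SimpleGraph U} {l : ℕ}
    (hl : Nat.card U ≤ l) (h : IsPathGraph C ∨ IsSubdividedClaw C) :
    C.IsContained (subdividedClaw fun _ => l) := by
  rcases h with ⟨n, -, ⟨e⟩⟩ | ⟨ℓ, -, ⟨e⟩⟩
  · refine IsContained.trans ⟨e.toCopy⟩ ?_
    have hn : n ≤ l := by
      rw [Nat.card_congr e.toEquiv, Nat.card_fin] at hl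
      exact hl
    refine ⟨⟨⟨fun j => some ⟨0, Fin.castLE hn j⟩, fun {a b} hab => ?_⟩, fun a b hab => ?_⟩⟩
    · rw [pathGraph_adj] at hab
      exact subdividedClaw_adj_some.2 ⟨rfl, by simp only [Fin.val_castLE]; omega⟩
    · have : Fin.castLE hn a = Fin.castLE hn b := by simpa using hab
      exact Fin.castLE_injective hn this
  · refine IsContained.trans ⟨e.toCopy⟩ ?_
    have hcard : ∀ i, ℓ i ≤ l := fun i => by
      rw [Nat.card_congr e.toEquiv] at hl
      refine le_trans ?_ hl
      have := Nat.card_le_card_of_injective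
        (fun j : Fin (ℓ i) => (some ⟨i, j⟩ : Option (Σ i : Fin 3, Fin (ℓ i))))
        fun a b hab => by simpa using hab
      simpa using this
    refine ⟨⟨⟨Option.map fun x => ⟨x.1, Fin.castLE (hcard x.1) x.2⟩, fun {a b} hab => ?_⟩,
      Option.map_injective ?_⟩⟩
    · rcases a with _ | ⟨i, j⟩ <;> rcases b with _ | ⟨i', j'⟩
      · exact absurd hab (SimpleGraph.irrefl _)
      · exact subdividedClaw_adj_none.2 (subdividedClaw_adj_none.1 hab)
      · exact SimpleGraph.Adj.symm (u := none)
          (subdividedClaw_adj_none.2 (subdividedClaw_adj_none.1 hab.symm))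
      · exact subdividedClaw_adj_some.2 (subdividedClaw_adj_some.1 hab)
    · rintro ⟨i, j⟩ ⟨i', j'⟩ hab
      simp only [Sigma.mk.injEq] at hab
      obtain ⟨rfl, hab⟩ := hab
      rw [Fin.castLE_injective _ (eq_of_heq hab)]

theorem hasBoundedTreewidth_of_memS {W : Type u} [Finite W] {H : SimpleGraph W} (hH : MemS H) :
    HasBoundedTreewidth (subgraphFree H) := by
  -- The summand `1` keeps the legs nonempty even if `W` is empty.
  let l := Nat.card W + 1
  let S := subdividedClaw fun _ => l
  let k := 3 * l + Nat.card W * Nat.card (Option (Σ _ : Fin 3, Fin l))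
  refine ⟨k, fun V _ G hG => ?_⟩
  have hcomp : ∀ C : H.ConnectedComponent, C.toSimpleGraph.IsContained S := fun C =>
    isContained_subdividedClaw
      ((Nat.card_le_card_of_injective _ Subtype.val_injective).trans (Nat.le_succ _)) (hH C)
  obtain ⟨f, hf⟩ | ⟨X, hX, hfree⟩ := exists_disjoint_copies_or S G (Nat.card W)
  · exact absurd (isContained_of_components hcomp f hf) hG
  · have h := (hasDecomposition_of_free (Nat.succ_pos _) hfree).of_induce_compl.treewidth_le
    exact h.trans ((Nat.sub_le _ _).trans (Nat.add_le_add_left hX _))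

/-! ### Connected graphs that map injectively to a path or a claw -/

/-- By connectedness the values of `g` fill an interval. Consecutive values belong to adjacent
vertices, because a walk between them has to cross the gap and injectivity leaves only one edge for
this. -/
theorem isPathGraph_of_injective_int {U : Type u} [Finite U] {C : SimpleGraph U} (hC : C.Connected)
    {g : U → ℤ} (hg : Function.Injective g)
    (hadj : ∀ x y, C.Adj x y → g y = g x + 1 ∨ g x = g y + 1) : IsPathGraph C := by
  have := hC.nonempty
  have := Fintype.ofFinite U
  obtain ⟨a, ha⟩ := Finite.exists_min g
  obtain ⟨b, hb⟩ := Finite.exists_max g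
  have hbetween : ∀ c, g a ≤ c → c ≤ g b → ∃ x, g x = c := by
    intro c hac hcb
    rcases hac.eq_or_lt with h | h
    · exact ⟨a, h⟩
    obtain ⟨z, w, hzw, hz, hw⟩ := exists_boundary_adj (hC.preconnected a b) {z | g z < c} h
      (not_lt.2 hcb)
    have hz : g z < c := hz
    have hw : ¬ g w < c := hw
    refine ⟨w, ?_⟩
    rcases hadj z w hzw with h | h <;> omega
  let n : ℕ := (g b - g a).toNat + 1
  have hab : g a ≤ g b := ha b
  let e : U → Fin n := fun x => ⟨(g x - g a).toNat, by
    have := ha x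
    have := hb x
    omega⟩
  have he : ∀ x, ((e x : ℕ) : ℤ) = g x - g a := fun x => Int.toNat_of_nonneg (by
    have := ha x
    omega)
  have hbij : Function.Bijective e := by
    constructor
    · intro x y hxy
      have hx := he x
      rw [hxy, he y] at hx
      exact hg (by omega)
    · intro j
      have := j.2
      obtain ⟨x, hx⟩ := hbetween (g a + j) (by omega) (by omega)
      have := he x
      exact ⟨x, Fin.ext (by omega)⟩
  have hback : ∀ x y, g y = g x + 1 → C.Adj x y := by
    intro x y hxy
    obtain ⟨z, w, hzw, hz, hw⟩ := exists_boundary_adj (hC.preconnected x y) {z | g z ≤ g x}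
      (le_refl (g x)) (by simp only [Set.mem_ofPred_eq]; omega)
    have hz : g z ≤ g x := hz
    have hw : ¬ g w ≤ g x := hw
    have h1 : z = x := hg (by rcases hadj z w hzw with h | h <;> omega)
    have h2 : w = y := hg (by rcases hadj z w hzw with h | h <;> omega)
    rwa [← h1, ← h2]
  refine ⟨n, Nat.succ_pos _, ⟨⟨Equiv.ofBijective e hbij, fun {x y} => ?_⟩⟩⟩
  have hx := he x
  have hy := he y
  rw [pathGraph_adj]
  simp only [Equiv.ofBijective_apply]
  constructor
  · rintro (h | h)
    · exact hback x y (by omega)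
    · exact (hback y x (by omega)).symm
  · intro h
    rcases hadj x y h with h | h <;> omega

/-- The claw with three infinite legs. -/
def infiniteClaw : SimpleGraph (Option (Fin 3 × ℕ)) :=
  SimpleGraph.fromRel fun
    | none, some (_, j) => j = 0
    | some (i, j), some (i', j') => i = i' ∧ j' = j + 1
    | _, none => False

theorem infiniteClaw_adj_none {i : Fin 3} {j : ℕ} :
    infiniteClaw.Adj none (some (i, j)) ↔ j = 0 := by
  simp [infiniteClaw, SimpleGraph.fromRel_adj]

theorem infiniteClaw_adj_some {i i' : Fin 3} {j j' : ℕ} :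
    infiniteClaw.Adj (some (i, j)) (some (i', j')) ↔ i = i' ∧ (j' = j + 1 ∨ j = j' + 1) := by
  simp only [infiniteClaw, SimpleGraph.fromRel_adj]
  constructor
  · rintro ⟨-, ⟨h, h'⟩ | ⟨h, h'⟩⟩
    exacts [⟨h, Or.inl h'⟩, ⟨h.symm, Or.inr h'⟩]
  · rintro ⟨rfl, h⟩
    refine ⟨fun heq => ?_, ?_⟩
    · have : j = j' := by simpa using heq
      omega
    · rcases h with h | h
      exacts [Or.inl ⟨rfl, h⟩, Or.inr ⟨rfl, h⟩]

section Classification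

variable {U : Type u} {C : SimpleGraph U} {φ : U → Option (Fin 3 × ℕ)}

theorem isPathGraph_of_missing_leg [Finite U] (hC : C.Connected) (hφ : Function.Injective φ)
    (hadj : ∀ x y, C.Adj x y → infiniteClaw.Adj (φ x) (φ y)) {i₀ : Fin 3}
    (hmiss : ∀ x j, φ x ≠ some (i₀, j)) : IsPathGraph C := by
  -- Without leg `i₀` the claw is a two-way infinite path: leg `i₀ + 1` becomes the positive half,
  -- the remaining leg the negative half.
  let h : Option (Fin 3 × ℕ) → ℤ := fun s =>
    s.elim 0 fun a => if a.1 = i₀ + 1 then (a.2 : ℤ) + 1 else -((a.2 : ℤ) + 1)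
  have hother : ∀ i : Fin 3, i ≠ i₀ → i ≠ i₀ + 1 → i = i₀ + 2 := by
    intro i
    fin_cases i <;> fin_cases i₀ <;> simp
  have hnone : h none = 0 := rfl
  have hsome : ∀ i j, h (some (i, j)) = if i = i₀ + 1 then (j : ℤ) + 1 else -((j : ℤ) + 1) :=
    fun i j => rfl
  refine isPathGraph_of_injective_int hC (g := fun x => h (φ x)) ?_ ?_
  · intro x y hxy
    apply hφ
    have hx := hmiss x
    have hy := hmiss y
    simp only at hxy
    revert hxy hx hy
    rcases φ x with _ | ⟨i, j⟩ <;> rcases φ y with _ | ⟨i', j'⟩ <;> intro hxy hx hy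
    · rfl
    · rw [hnone, hsome] at hxy
      split_ifs at hxy <;> omega
    · rw [hnone, hsome] at hxy
      split_ifs at hxy <;> omega
    · have hi : i ≠ i₀ := fun h => hx j (h ▸ rfl)
      have hi' : i' ≠ i₀ := fun h => hy j' (h ▸ rfl)
      rw [hsome, hsome] at hxy
      split_ifs at hxy with h1 h2 h2
      · rw [h1, h2, show j = j' by omega]
      · omega
      · omega
      · rw [hother i hi h1, hother i' hi' h2, show j = j' by omega]
  · intro x y hxy
    have := hadj x y hxy
    revert this
    rcases φ x with _ | ⟨i, j⟩ <;> rcases φ y with _ | ⟨i', j'⟩ <;> intro this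
    · exact absurd this (SimpleGraph.irrefl _)
    · have := infiniteClaw_adj_none.1 this
      rw [hnone, hsome]
      split_ifs <;> omega
    · have := infiniteClaw_adj_none.1 this.symm
      rw [hnone, hsome]
      split_ifs <;> omega
    · obtain ⟨rfl, this⟩ := infiniteClaw_adj_some.1 this
      rw [hsome, hsome]
      split_ifs <;> omega

/-- Where a connected graph mapped to the infinite claw enters the part of a leg beyond a vertex,
it does so through the edge below this vertex. -/
theorem exists_leg_crossing (hC : C.Connected)
    (hadj : ∀ x y, C.Adj x y → infiniteClaw.Adj (φ x) (φ y)) {x y : U} {i : Fin 3} {j k : ℕ}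
    (hkj : k ≤ j) (hx : φ x = some (i, j)) (hy : ∀ j', φ y = some (i, j') → j' < k) :
    ∃ z w, C.Adj z w ∧ φ z = some (i, k) ∧ φ w = if k = 0 then none else some (i, k - 1) := by
  obtain ⟨z, w, hzw, ⟨j₁, hj₁, hz⟩, hw⟩ := exists_boundary_adj (hC.preconnected x y)
    {z | ∃ j', k ≤ j' ∧ φ z = some (i, j')} ⟨j, hkj, hx⟩
    (fun ⟨j', hj', h⟩ => absurd (hy j' h) (not_lt.2 hj'))
  have h := hadj z w hzw
  have hw : ∀ j', φ w = some (i, j') → j' < k := fun j' h => by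
    by_contra hcon
    exact hw ⟨j', not_lt.1 hcon, h⟩
  refine ⟨z, w, hzw, ?_⟩
  rw [hz] at h ⊢
  rcases hφw : φ w with _ | ⟨i', j'⟩
  · rw [hφw] at h
    have := infiniteClaw_adj_none.1 h.symm
    obtain rfl : j₁ = k := by omega
    simp [this]
  · rw [hφw] at h
    obtain ⟨rfl, h⟩ := infiniteClaw_adj_some.1 h
    have := hw j' hφw
    have h1 : j₁ = k := by omega
    have h2 : j' = k - 1 := by omega
    have h3 : k ≠ 0 := by omega
    simp [h1, h2, h3]

/-- A vertex on another leg always lies outside leg `i`, so `exists_leg_crossing` applies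
everywhere. It shows that the image is closed towards the centre and that every edge of the infinite
claw within the image comes from an edge of `C`. -/
theorem isSubdividedClaw_of_legs [Finite U] (hC : C.Connected) (hφ : Function.Injective φ)
    (hadj : ∀ x y, C.Adj x y → infiniteClaw.Adj (φ x) (φ y))
    (hlegs : ∀ i, ∃ x j, φ x = some (i, j)) : IsSubdividedClaw C := by
  classical
  have hcross : ∀ {x i j k}, k ≤ j → φ x = some (i, j) → ∃ z w, C.Adj z w ∧ φ z = some (i, k) ∧
      φ w = if k = 0 then none else some (i, k - 1) := by
    intro x i j k hkj hx
    obtain ⟨y, j', hy⟩ := hlegs (i + 1)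
    refine exists_leg_crossing (y := y) hC hadj hkj hx fun j'' h => ?_
    rw [hy] at h
    have : i + 1 = i := by simp at h
    simp at this
  have hfin : ∀ i, ∃ j, ∀ x, φ x ≠ some (i, j) := by
    intro i
    by_contra hcon
    push Not at hcon
    choose x hx using hcon
    have : Function.Injective x := fun a b hab => by
      have := (hx a).symm.trans ((congrArg φ hab).trans (hx b))
      simpa using this
    exact not_injective_infinite_finite x this
  let ℓ : Fin 3 → ℕ := fun i => Nat.find (hfin i)
  have hℓ : ∀ i j, (∃ x, φ x = some (i, j)) ↔ j < ℓ i := by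
    intro i j
    constructor
    · rintro ⟨x, hx⟩
      by_contra hcon
      obtain ⟨z, -, -, hz, -⟩ := hcross (not_lt.1 hcon) hx
      exact Nat.find_spec (hfin i) z hz
    · intro hj
      have := Nat.find_min (hfin i) hj
      push Not at this
      exact this
  have hnone : ∃ x, φ x = none := by
    obtain ⟨x, j, hx⟩ := hlegs 0
    obtain ⟨-, w, -, -, hw⟩ := hcross (Nat.zero_le j) hx
    exact ⟨w, by simpa using hw⟩
  let ι : Option (Σ i : Fin 3, Fin (ℓ i)) → Option (Fin 3 × ℕ) := Option.map fun a => (a.1, a.2.1)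
  have hι : Function.Injective ι := by
    refine Option.map_injective ?_
    rintro ⟨i, j⟩ ⟨i', j'⟩ hab
    simp only [Prod.mk.injEq] at hab
    obtain ⟨rfl, hab⟩ := hab
    rw [Fin.ext hab]
  have hrange : Set.range φ = Set.range ι := by
    ext s
    rcases s with _ | ⟨i, j⟩
    · exact ⟨fun _ => ⟨none, rfl⟩, fun _ => hnone⟩
    · refine (hℓ i j).trans ⟨fun h => ⟨some ⟨i, j, h⟩, rfl⟩, ?_⟩
      rintro ⟨_ | ⟨i', j'⟩, h⟩
      · simp [ι] at h
      · have h : (i', (j' : ℕ)) = (i, j) := Option.some.inj h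
        obtain ⟨rfl, rfl⟩ := Prod.mk.inj h
        exact j'.2
  let e : U ≃ Option (Σ i : Fin 3, Fin (ℓ i)) :=
    (Equiv.ofInjective φ hφ).trans ((Equiv.setCongr hrange).trans (Equiv.ofInjective ι hι).symm)
  have he : ∀ x, ι (e x) = φ x := fun x => Equiv.apply_ofInjective_symm hι _
  have hιadj : ∀ a b, infiniteClaw.Adj (ι a) (ι b) ↔ (subdividedClaw ℓ).Adj a b := by
    rintro (_ | ⟨i, j⟩) (_ | ⟨i', j'⟩)
    · exact ⟨fun h => absurd h (SimpleGraph.irrefl _), fun h => absurd h (SimpleGraph.irrefl _)⟩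
    · exact infiniteClaw_adj_none.trans subdividedClaw_adj_none.symm
    · rw [SimpleGraph.adj_comm, SimpleGraph.adj_comm (subdividedClaw ℓ)]
      exact infiniteClaw_adj_none.trans subdividedClaw_adj_none.symm
    · exact infiniteClaw_adj_some.trans subdividedClaw_adj_some.symm
  have hback : ∀ x y i k, φ x = some (i, k) → (φ y = if k = 0 then none else some (i, k - 1)) →
      C.Adj x y := by
    intro x y i k hx hy
    obtain ⟨z, w, hzw, hz, hw⟩ := hcross le_rfl hx
    rwa [← hφ (hz.trans hx.symm), ← hφ (hw.trans hy.symm)]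
  refine ⟨ℓ, fun i => ?_, ⟨⟨e, fun {x y} => ?_⟩⟩⟩
  · obtain ⟨x, j, hx⟩ := hlegs i
    have := (hℓ i j).1 ⟨x, hx⟩
    omega
  · rw [← hιadj, he, he]
    refine ⟨fun h => ?_, hadj x y⟩
    rcases hx : φ x with _ | ⟨i, j⟩ <;> rcases hy : φ y with _ | ⟨i', j'⟩ <;> rw [hx, hy] at h
    · exact absurd h (SimpleGraph.irrefl _)
    · have := infiniteClaw_adj_none.1 h
      exact (hback y x i' j' hy (by rw [hx, if_pos this])).symm
    · have := infiniteClaw_adj_none.1 h.symm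
      exact hback x y i j hx (by rw [hy, if_pos this])
    · obtain ⟨rfl, rfl | rfl⟩ := infiniteClaw_adj_some.1 h
      · exact (hback y x i (j + 1) hy (by simpa using hx)).symm
      · exact hback x y i (j' + 1) hx (by simpa using hy)

theorem isPathGraph_or_isSubdividedClaw [Finite U] (hC : C.Connected) (hφ : Function.Injective φ)
    (hadj : ∀ x y, C.Adj x y → infiniteClaw.Adj (φ x) (φ y)) :
    IsPathGraph C ∨ IsSubdividedClaw C := by
  by_cases h : ∀ i, ∃ x j, φ x = some (i, j)
  · exact Or.inr (isSubdividedClaw_of_legs hC hφ hadj h)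
  · push Not at h
    obtain ⟨i, hi⟩ := h
    exact Or.inl (isPathGraph_of_missing_leg hC hφ hadj hi)

end Classification

/-! ### Claws linked at their tips -/

section LinkedClaws

variable {B : Type v} {σ : B × Fin 3 → B × Fin 3} {L : ℕ}

/-- A family of disjoint claws with legs of length `L`, whose tips are joined in pairs as
prescribed by `σ`. -/
def linkedClaws (σ : B × Fin 3 → B × Fin 3) (L : ℕ) : SimpleGraph (B × Option (Fin 3 × Fin L)) :=
  SimpleGraph.fromRel fun
    | (b, none), (b', some (_, j)) => b = b' ∧ (j : ℕ) = 0
    | (b, some (i, j)), (b', some (i', j')) => (b = b' ∧ i = i' ∧ (j' : ℕ) = j + 1) ∨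
        ((j : ℕ) + 1 = L ∧ (j' : ℕ) + 1 = L ∧ σ (b, i) = (b', i'))
    | _, (_, none) => False

theorem linkedClaws_adj_none {b b' : B} {i : Fin 3} {j : Fin L} :
    (linkedClaws σ L).Adj (b, none) (b', some (i, j)) ↔ b = b' ∧ (j : ℕ) = 0 := by
  simp [linkedClaws, SimpleGraph.fromRel_adj]

theorem linkedClaws_not_adj_none {b b' : B} : ¬ (linkedClaws σ L).Adj (b, none) (b', none) := by
  simp [linkedClaws, SimpleGraph.fromRel_adj]

theorem linkedClaws_adj_some (hσ : Function.Involutive σ) (hne : ∀ h, (σ h).1 ≠ h.1) {b b' : B}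
    {i i' : Fin 3} {j j' : Fin L} :
    (linkedClaws σ L).Adj (b, some (i, j)) (b', some (i', j')) ↔
      (b = b' ∧ i = i' ∧ ((j' : ℕ) = j + 1 ∨ (j : ℕ) = j' + 1)) ∨
        ((j : ℕ) + 1 = L ∧ (j' : ℕ) + 1 = L ∧ σ (b, i) = (b', i')) := by
  simp only [linkedClaws, SimpleGraph.fromRel_adj]
  constructor
  · rintro ⟨-, (⟨h1, h2, h3⟩ | h) | ⟨h1, h2, h3⟩ | ⟨h1, h2, h3⟩⟩
    · exact Or.inl ⟨h1, h2, Or.inl h3⟩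
    · exact Or.inr h
    · exact Or.inl ⟨h1.symm, h2.symm, Or.inr h3⟩
    · exact Or.inr ⟨h2, h1, by rw [← h3, hσ]⟩
  · rintro (⟨rfl, rfl, h⟩ | h)
    · refine ⟨fun heq => ?_, ?_⟩
      · have : j = j' := by simpa using heq
        subst this
        omega
      · rcases h with h | h
        exacts [Or.inl (Or.inl ⟨rfl, rfl, h⟩), Or.inr (Or.inl ⟨rfl, rfl, h⟩)]
    · refine ⟨fun heq => hne (b, i) ?_, Or.inl (Or.inr h)⟩
      rw [h.2.2]
      exact (Prod.mk.inj heq).1.symm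

/-- The vertex `x` of the linked claws lies at position `s` of the claw around `b`, whose legs
are extended by the legs linked to them. -/
def IsPosition (σ : B × Fin 3 → B × Fin 3) (b : B) :
    B × Option (Fin 3 × Fin L) → Option (Fin 3 × ℕ) → Prop
  | (b', none), none => b' = b
  | (b', some (i', j)), some (i, k) =>
      (b' = b ∧ i' = i ∧ k = j) ∨ (σ (b', i') = (b, i) ∧ k + j + 1 = 2 * L)
  | _, _ => False

/-- The distance from the centre in the infinite claw. -/
def height (s : Option (Fin 3 × ℕ)) : ℕ := s.elim 0 fun a => a.2 + 1

/-- On each leg, the positions `k < L` belong to the claw at `b` and those from `L` to `2 * L - 1`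
to the linked leg, read from its tip; injectivity of `σ` singles out that leg. -/
theorem IsPosition.injective (hσ : Function.Involutive σ) {b : B}
    {x y : B × Option (Fin 3 × Fin L)} {s : Option (Fin 3 × ℕ)} (hx : IsPosition σ b x s)
    (hy : IsPosition σ b y s) : x = y := by
  rcases x with ⟨a, _ | ⟨i, j⟩⟩ <;> rcases y with ⟨a', _ | ⟨i', j'⟩⟩ <;> rcases s with _ | ⟨i₀, k⟩
  · rw [show a = b from hx, show a' = b from hy]
  · exact hx.elim
  · exact hy.elim
  · exact hx.elim
  · exact hx.elim
  · exact hy.elim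
  · exact hx.elim
  · have hj := j.2
    have hj' := j'.2
    rcases hx with ⟨rfl, rfl, h⟩ | ⟨h1, h2⟩ <;> rcases hy with ⟨rfl, rfl, h'⟩ | ⟨h1', h2'⟩
    · rw [show j = j' from Fin.ext (by omega)]
    · omega
    · omega
    · have := hσ.injective (h1.trans h1'.symm)
      obtain ⟨rfl, rfl⟩ := Prod.mk.inj this
      rw [show j = j' from Fin.ext (by omega)]

/-- The centres of other claws have no position, so edges between vertices with positions run along
one extended leg or at the centre `b`. By `hne` no link returns to its own claw. -/
theorem IsPosition.adj (hσ : Function.Involutive σ) (hne : ∀ h, (σ h).1 ≠ h.1) {b : B}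
    {x y : B × Option (Fin 3 × Fin L)} {s t : Option (Fin 3 × ℕ)} (hx : IsPosition σ b x s)
    (hy : IsPosition σ b y t) (hxy : (linkedClaws σ L).Adj x y) : infiniteClaw.Adj s t := by
  have key : ∀ {i : Fin 3} {j : Fin L} {b₁ b₂ : B} {s t : Option (Fin 3 × ℕ)},
      IsPosition (L := L) σ b (b₁, none) s → IsPosition σ b (b₂, some (i, j)) t → b₁ = b₂ →
      (j : ℕ) = 0 → infiniteClaw.Adj s t := by
    rintro i j b₁ b₂ (_ | _) (_ | ⟨i₀, k⟩) hs ht rfl h0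
    · exact ht.elim
    · obtain rfl : b₁ = b := hs
      rcases ht with ⟨-, rfl, rfl⟩ | ⟨h1, -⟩
      · exact infiniteClaw_adj_none.2 h0
      · exact absurd (congrArg Prod.fst h1) (hne _)
    · exact hs.elim
    · exact hs.elim
  rcases x with ⟨a, _ | ⟨i, j⟩⟩ <;> rcases y with ⟨a', _ | ⟨i', j'⟩⟩
  · exact absurd hxy linkedClaws_not_adj_none
  · obtain ⟨h1, h2⟩ := linkedClaws_adj_none.1 hxy
    exact key hx hy h1 h2
  · obtain ⟨h1, h2⟩ := linkedClaws_adj_none.1 hxy.symm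
    exact (key hy hx h1 h2).symm
  · rcases s with _ | ⟨i₁, k⟩
    · exact hx.elim
    rcases t with _ | ⟨i₂, k'⟩
    · exact hy.elim
    rw [infiniteClaw_adj_some]
    rcases (linkedClaws_adj_some hσ hne).1 hxy with ⟨rfl, rfl, h⟩ | ⟨h1, h2, h3⟩
    · rcases hx with ⟨rfl, rfl, hk⟩ | ⟨hx, hk⟩ <;> rcases hy with ⟨ha, rfl, hk'⟩ | ⟨hy, hk'⟩
      · exact ⟨rfl, by omega⟩
      · exact absurd (congrArg Prod.fst hy) (hne _)
      · exact absurd (congrArg Prod.fst hx) (ha ▸ hne _)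
      · exact ⟨(Prod.mk.inj (hx.symm.trans hy)).2, by omega⟩
    · rcases hx with ⟨rfl, rfl, hk⟩ | ⟨hx, hk⟩ <;> rcases hy with ⟨rfl, rfl, hk'⟩ | ⟨hy, hk'⟩
      · exact absurd (congrArg Prod.fst h3) (hne _)
      · rw [← h3, hσ] at hy
        exact ⟨(Prod.mk.inj hy).2, by omega⟩
      · exact ⟨(Prod.mk.inj (hx.symm.trans h3)).2, by omega⟩
      · rw [h3] at hx
        rw [(Prod.mk.inj hx).1, (Prod.mk.inj hx).2] at hy h3
        exact absurd (congrArg Prod.fst hy) (hne _)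

/-- Only at height `2 * L` can a neighbour lack a position: there it may be the centre of another
claw. -/
theorem IsPosition.exists_adj (hσ : Function.Involutive σ) (hne : ∀ h, (σ h).1 ≠ h.1) {b : B}
    {x y : B × Option (Fin 3 × Fin L)} {s : Option (Fin 3 × ℕ)} (hx : IsPosition σ b x s)
    (hs : height s < 2 * L) (hxy : (linkedClaws σ L).Adj x y) :
    ∃ t, IsPosition σ b y t ∧ height t ≤ height s + 1 := by
  rcases x with ⟨a, _ | ⟨i, j⟩⟩ <;> rcases y with ⟨a', _ | ⟨i', j'⟩⟩ <;> rcases s with _ | ⟨i₁, k⟩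
  · exact absurd hxy linkedClaws_not_adj_none
  · exact hx.elim
  · obtain ⟨rfl, h2⟩ := linkedClaws_adj_none.1 hxy
    refine ⟨some (i', 0), Or.inl ⟨hx, rfl, h2.symm⟩, le_rfl⟩
  · exact hx.elim
  · exact hx.elim
  · obtain ⟨rfl, h2⟩ := linkedClaws_adj_none.1 hxy.symm
    have hs : k + 1 < 2 * L := hs
    rcases hx with ⟨rfl, -, -⟩ | ⟨-, h⟩
    · exact ⟨none, rfl, Nat.zero_le _⟩
    · omega
  · exact hx.elim
  · have hj := j.2
    have hj' := j'.2
    have hheight : ∀ {i k'}, k' ≤ k + 1 →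
        height (some (i, k')) ≤ height (some (i₁, k)) + 1 := fun h => Nat.succ_le_succ h
    rcases (linkedClaws_adj_some hσ hne).1 hxy with ⟨rfl, rfl, h⟩ | ⟨h1, h2, h3⟩
    · rcases hx with ⟨rfl, rfl, hk⟩ | ⟨hx, hk⟩
      · exact ⟨some (i, j'), Or.inl ⟨rfl, rfl, rfl⟩, hheight (by omega)⟩
      · exact ⟨some (i₁, 2 * L - 1 - j'), Or.inr ⟨hx, by omega⟩, hheight (by omega)⟩
    · rcases hx with ⟨rfl, rfl, hk⟩ | ⟨hx, hk⟩
      · exact ⟨some (i, L), Or.inr ⟨by rw [← h3, hσ], by omega⟩, hheight (by omega)⟩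
      · obtain ⟨rfl, rfl⟩ := Prod.mk.inj (h3.symm.trans hx)
        exact ⟨some (i', j'), Or.inl ⟨rfl, rfl, rfl⟩, hheight (by omega)⟩

/-- Positions are taken around the claw containing `f x₀`, where the height is at most `L`. Paths in
`C` have fewer than `L` edges, so they never climb past the region where positions exist. -/
theorem isPathGraph_or_isSubdividedClaw_of_copy (hσ : Function.Involutive σ)
    (hne : ∀ h, (σ h).1 ≠ h.1) {U : Type u} [Finite U] {C : SimpleGraph U} (hC : C.Connected)
    (hL : Nat.card U ≤ L) (f : Copy C (linkedClaws σ L)) : IsPathGraph C ∨ IsSubdividedClaw C := by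
  have := Fintype.ofFinite U
  rw [Nat.card_eq_fintype_card] at hL
  obtain ⟨x₀⟩ := hC.nonempty
  have hstart : ∃ s, IsPosition σ (f x₀).1 (f x₀) s ∧ height s ≤ L := by
    rcases f x₀ with ⟨b, _ | ⟨i, j⟩⟩
    · exact ⟨none, rfl, Nat.zero_le _⟩
    · exact ⟨some (i, j), Or.inl ⟨rfl, rfl, rfl⟩, j.2⟩
  have hwalk : ∀ (x y : U) (p : C.Walk x y) (m : ℕ), m + p.length ≤ 2 * L →
      (∃ s, IsPosition σ (f x₀).1 (f x) s ∧ height s ≤ m) →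
      ∃ s, IsPosition σ (f x₀).1 (f y) s := by
    intro x y p
    induction p with
    | nil => exact fun m _ ⟨s, hs, _⟩ => ⟨s, hs⟩
    | cons h p ih =>
      rintro m hm ⟨s, hs, hsm⟩
      rw [Walk.length_cons] at hm
      obtain ⟨t, ht, hts⟩ := hs.exists_adj hσ hne (by omega) (f.toHom.map_adj h)
      exact ih (m + 1) (by omega) ⟨t, ht, by omega⟩
  have hpos : ∀ y, ∃ s, IsPosition σ (f x₀).1 (f y) s := by
    intro y
    obtain ⟨p, hp⟩ := hC.exists_isPath x₀ y
    have := hp.length_lt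
    exact hwalk _ _ p L (by omega) hstart
  choose φ hφ using hpos
  refine isPathGraph_or_isSubdividedClaw (φ := φ) hC (fun x y hxy => ?_) fun x y hxy =>
    (hφ x).adj hσ hne (hφ y) (f.toHom.map_adj hxy)
  have hy := hφ y
  rw [← hxy] at hy
  exact f.injective ((hφ x).injective hσ hy)

theorem memS_of_isContained_linkedClaws (hσ : Function.Involutive σ) (hne : ∀ h, (σ h).1 ≠ h.1)
    {W : Type u} [Finite W] {H : SimpleGraph W} (hL : Nat.card W ≤ L)
    (h : H.IsContained (linkedClaws σ L)) : MemS H := by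
  intro C
  obtain ⟨f⟩ := h
  exact isPathGraph_or_isSubdividedClaw_of_copy hσ hne C.connected_toSimpleGraph
    ((Nat.card_le_card_of_injective _ Subtype.val_injective).trans hL)
    (f.comp (Copy.induce H C.supp))

/-- A union of claws is connected if any two of its claws are connected by links. -/
theorem linkedClaws_preconnected (hσ : Function.Involutive σ) (hne : ∀ h, (σ h).1 ≠ h.1)
    (hL : 0 < L) {Q : Set B}
    (hQ : ∀ b ∈ Q, ∀ b' ∈ Q, Relation.EqvGen (fun b b' => b ∈ Q ∧ b' ∈ Q ∧
      ∃ i i', σ (b, i) = (b', i')) b b') :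
    ((linkedClaws σ L).induce {x | x.1 ∈ Q}).Preconnected := by
  let G := (linkedClaws σ L).induce {x | x.1 ∈ Q}
  have hleg : ∀ b (hb : b ∈ Q) (i : Fin 3) (j : ℕ) (hj : j < L),
      G.Reachable ⟨(b, none), hb⟩ ⟨(b, some (i, ⟨j, hj⟩)), hb⟩ := by
    intro b hb i j
    induction j with
    | zero =>
      intro hj
      exact Adj.reachable ((linkedClaws_adj_none (σ := σ)).2 ⟨rfl, rfl⟩)
    | succ j ih =>
      exact fun hj => (ih (by omega)).trans (Adj.reachable
        ((linkedClaws_adj_some hσ hne).2 (Or.inl ⟨rfl, rfl, Or.inl rfl⟩)))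
  have hcentre : ∀ b b', Relation.EqvGen (fun b b' => b ∈ Q ∧ b' ∈ Q ∧
      ∃ i i', σ (b, i) = (b', i')) b b' → ∀ (hb : b ∈ Q) (hb' : b' ∈ Q),
      G.Reachable ⟨(b, none), hb⟩ ⟨(b', none), hb'⟩ := by
    intro b b' h
    have : b = b' ∨ ∃ (hb : b ∈ Q) (hb' : b' ∈ Q),
        G.Reachable ⟨(b, none), hb⟩ ⟨(b', none), hb'⟩ := by
      induction h with
      | rel b b' h =>
        obtain ⟨hb, hb', i, i', h⟩ := h
        refine Or.inr ⟨hb, hb', (hleg b hb i (L - 1) (by omega)).trans (Reachable.trans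
          (Adj.reachable ?_) (hleg b' hb' i' (L - 1) (by omega)).symm)⟩
        exact (linkedClaws_adj_some hσ hne).2 (Or.inr ⟨by simp only; omega, by simp only; omega, h⟩)
      | refl => exact Or.inl rfl
      | symm b b' _ ih =>
        rcases ih with rfl | ⟨hb, hb', h⟩
        exacts [Or.inl rfl, Or.inr ⟨hb', hb, h.symm⟩]
      | trans a b c _ _ ih ih' =>
        rcases ih with rfl | ⟨ha, hb, h⟩
        · exact ih'
        · rcases ih' with rfl | ⟨hb', hc, h'⟩
          exacts [Or.inr ⟨ha, hb, h⟩, Or.inr ⟨ha, hc, h.trans h'⟩]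
    rcases this with rfl | ⟨hb, hb', h⟩
    · exact fun _ _ => Reachable.refl _
    · exact fun _ _ => h
  have hall : ∀ x : {x : B × Option (Fin 3 × Fin L) | x.1 ∈ Q},
      G.Reachable ⟨(x.1.1, none), x.2⟩ x := by
    rintro ⟨⟨b, _ | ⟨i, j⟩⟩, hb⟩
    · exact Reachable.refl _
    · exact hleg b hb i j j.2
  exact fun x y => (hall x).symm.trans ((hcentre _ _ (hQ _ x.2 _ y.2) _ _).trans (hall y))

end LinkedClaws

/-! ### Two families of paths linked like the rows and columns of a grid -/

/-- The links of a grid-like graph: `(false, i, j)` is the `j`-th vertex of the `i`-th row and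
`(true, j, i)` is the `i`-th vertex of the `j`-th column, and these two are linked, as are
consecutive vertices of a row or column. -/
def gridLink (k : ℕ) : (Bool × Fin (k + 2) × Fin (k + 2)) × Fin 3 →
    (Bool × Fin (k + 2) × Fin (k + 2)) × Fin 3
  | ((s, i, j), 0) => ((s, i, j + 1), 1)
  | ((s, i, j), 1) => ((s, i, j - 1), 0)
  | ((s, i, j), 2) => ((!s, j, i), 2)

theorem gridLink_involutive (k : ℕ) : Function.Involutive (gridLink k) := by
  rintro ⟨⟨s, i, j⟩, a⟩
  fin_cases a <;> simp [gridLink]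

theorem gridLink_ne (k : ℕ) (h) : (gridLink k h).1 ≠ h.1 := by
  obtain ⟨⟨s, i, j⟩, a⟩ := h
  fin_cases a <;> simp [gridLink]

/-- Row `i` and column `j` are each connected, and the link between `(false, i, j)` and `(true, j,
i)` joins them. -/
theorem gridLink_preconnected (k : ℕ) {L : ℕ} (hL : 0 < L) (i j : Fin (k + 2)) :
    ((linkedClaws (gridLink k) L).induce
      {x | x.1 ∈ {b : Bool × Fin (k + 2) × Fin (k + 2) |
        (b.1, b.2.1) = (false, i) ∨ (b.1, b.2.1) = (true, j)}}).Preconnected := by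
  refine linkedClaws_preconnected (gridLink_involutive k) (gridLink_ne k) hL ?_
  set Q := {b : Bool × Fin (k + 2) × Fin (k + 2) |
    (b.1, b.2.1) = (false, i) ∨ (b.1, b.2.1) = (true, j)}
  set R := Relation.EqvGen fun b b' => b ∈ Q ∧ b' ∈ Q ∧ ∃ i i', gridLink k (b, i) = (b', i')
  have hline : ∀ s a, (∀ c, (s, a, c) ∈ Q) → ∀ c, R (s, a, 0) (s, a, c) := by
    intro s a hQ c
    induction c using Fin.induction with
    | zero => exact .refl _
    | succ c ih =>
      refine .trans _ _ _ ih (.rel _ _ ⟨hQ _, hQ _, 0, 1, ?_⟩)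
      simp [gridLink]
  have hrow : ∀ c, (false, i, c) ∈ Q := fun c => Or.inl rfl
  have hcol : ∀ c, (true, j, c) ∈ Q := fun c => Or.inr rfl
  have hall : ∀ b ∈ Q, R (false, i, 0) b := by
    rintro ⟨s, a, c⟩ hb
    rcases hb with h | h
    · obtain ⟨rfl, rfl⟩ := Prod.mk.inj h
      exact hline _ _ hrow c
    · obtain ⟨rfl, rfl⟩ := Prod.mk.inj h
      refine .trans _ _ _ (hline _ _ hrow a) (.trans _ _ _
        (.rel _ _ ⟨hrow _, hcol i, 2, 2, rfl⟩)
        (.trans _ _ _ (.symm _ _ (hline _ _ hcol i)) (hline _ _ hcol c)))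
  exact fun b hb b' hb' => .trans _ _ _ (.symm _ _ (hall b hb)) (hall b' hb')

/-- Any two crosses touch, where the row of one is linked to the column of the other, so some bag
meets all crosses. But `k + 1` vertices miss one of the `k + 2` rows and one of the `k + 2` columns,
and thus a whole cross. -/
theorem not_hasDecomposition_gridLink (k : ℕ) {L : ℕ} (hL : 0 < L) :
    ¬ HasDecomposition (linkedClaws (gridLink k) L) (k + 1) := by
  classical
  rintro ⟨D, hD⟩
  obtain ⟨t, ht⟩ := D.exists_bag_hitting (fun a : Fin (k + 2) × Fin (k + 2) =>
      {x | x.1 ∈ {b : Bool × Fin (k + 2) × Fin (k + 2) |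
        (b.1, b.2.1) = (false, a.1) ∨ (b.1, b.2.1) = (true, a.2)}})
    (fun a => gridLink_preconnected k hL a.1 a.2) (by
      rintro ⟨i, j⟩ ⟨i', j'⟩
      refine ⟨((false, i, j'), some (2, ⟨L - 1, by omega⟩)), Or.inl rfl,
        ((true, j', i), some (2, ⟨L - 1, by omega⟩)), Or.inr rfl, Or.inr ?_⟩
      rw [linkedClaws_adj_some (gridLink_involutive k) (gridLink_ne k)]
      exact Or.inr ⟨by simp only; omega, by simp only; omega, rfl⟩)
  have hmiss : ∀ s, ∃ i, ∀ x ∈ D.bag t, (x.1.1, x.1.2.1) ≠ (s, i) := by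
    intro s
    obtain ⟨y, hy, hy'⟩ := Finset.exists_mem_notMem_of_card_lt_card
      (s := (D.bag t).image fun x => (x.1.1, x.1.2.1))
      (t := Finset.univ.image fun i : Fin (k + 2) => (s, i)) (by
        rw [Finset.card_image_of_injective _ (Prod.mk_right_injective s), Finset.card_fin]
        exact Nat.lt_succ_of_le (Finset.card_image_le.trans (hD t)))
    obtain ⟨i, -, rfl⟩ := Finset.mem_image.1 hy
    exact ⟨i, fun x hx h => hy' (Finset.mem_image.2 ⟨x, hx, h⟩)⟩
  obtain ⟨i, hi⟩ := hmiss false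
  obtain ⟨j, hj⟩ := hmiss true
  obtain ⟨x, hx, h | h⟩ := ht (i, j)
  exacts [hi x hx h, hj x hx h]

theorem memS_of_hasBoundedTreewidth {W : Type u} [Finite W] {H : SimpleGraph W}
    (hH : HasBoundedTreewidth (subgraphFree H)) : MemS H := by
  obtain ⟨c, hc⟩ := hH
  let L := Nat.card W + 1
  let G := linkedClaws (gridLink c) L
  -- The linked claws live in `Type`; lifting makes them eligible for a class of graphs in `Type u`.
  let e : G.comap Equiv.ulift.{u} ≃g G := Iso.comap Equiv.ulift G
  refine memS_of_isContained_linkedClaws (gridLink_involutive c) (gridLink_ne c)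
    (Nat.le_succ (Nat.card W)) ?_
  by_contra hfree
  have hfree' : subgraphFree H _ (G.comap Equiv.ulift.{u}) := fun h => hfree (h.trans ⟨e.toCopy⟩)
  exact not_hasDecomposition_gridLink c (Nat.succ_pos _)
    ((hasDecomposition_of_treewidth_le (hc _ _ hfree')).of_iso e)

/-! ### The clique number -/

theorem treewidth_le_induce_univ {V : Type u} [Finite V] (G : SimpleGraph V) :
    treewidth G ≤ treewidth (G.induce Set.univ) :=
  ((hasDecomposition_of_treewidth_le le_rfl).of_iso (SimpleGraph.induceUnivIso G)).treewidth_le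

/-- A clique with `Nat.card W` vertices would contain `H`, so only the values of `f` below `Nat.card
W` matter. -/
theorem hasBoundedTreewidth_of_isTwOmegaBounded {W : Type u} [Finite W] {H : SimpleGraph W}
    (hH : IsTwOmegaBounded (subgraphFree H)) : HasBoundedTreewidth (subgraphFree H) := by
  obtain ⟨f, hf⟩ := hH
  refine ⟨(Finset.range (Nat.card W)).sup f, fun V _ G hG => (treewidth_le_induce_univ G).trans
    ((hf V G hG Set.univ).trans (Finset.le_sup (f := f) (Finset.mem_range.2 ?_)))⟩
  by_contra hcon
  obtain ⟨s, hs⟩ := (G.induce Set.univ).exists_isNClique_cliqueNum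
  have := Fintype.ofFinite W
  obtain ⟨g⟩ : Nonempty (W ↪ s) := Function.Embedding.nonempty_of_card_le (by
    rw [Fintype.card_coe, hs.card_eq, ← Nat.card_eq_fintype_card]
    exact not_lt.1 hcon)
  refine hG ⟨⟨⟨fun w => (g w).1.1, fun {a b} hab => ?_⟩, fun a b hab => ?_⟩⟩
  · exact hs.isClique (g a).2 (g b).2 fun h => hab.ne (g.injective (Subtype.ext h))
  · exact g.injective (Subtype.ext (Subtype.ext hab))

theorem isTwOmegaBounded_of_hasBoundedTreewidth {W : Type u} {H : SimpleGraph W}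
    (hH : HasBoundedTreewidth (subgraphFree H)) : IsTwOmegaBounded (subgraphFree H) := by
  obtain ⟨c, hc⟩ := hH
  exact ⟨fun _ => c, fun V _ G hG s => hc _ _ fun h => hG (h.trans ⟨Copy.induce G s⟩)⟩

end TwOmega

theorem mainTheorem6 {W : Type*} [Finite W] (H : SimpleGraph W) :
    List.TFAE
      [TwOmega.IsTwOmegaBounded (TwOmega.subgraphFree H),
        TwOmega.HasBoundedTreewidth (TwOmega.subgraphFree H),
        TwOmega.MemS H] := by
  tfae_have 1 → 2 := TwOmega.hasBoundedTreewidth_of_isTwOmegaBounded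
  tfae_have 2 → 1 := TwOmega.isTwOmegaBounded_of_hasBoundedTreewidth
  tfae_have 2 → 3 := TwOmega.memS_of_hasBoundedTreewidth
  tfae_have 3 → 2 := TwOmega.hasBoundedTreewidth_of_memS
  tfae_finish
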